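/- Let $H$ be a complex Hilbert space of arbitrary (finite or infinite, possibly uncountable) dimension, and let $\mathcal M$ be the set of density operators on $H$, i.e. of positive trace class operators $\rho$ with $\operatorname{tr}\rho=1$. For $\varphi,\psi\in\mathcal M$ let the Umegaki distance be \[ D_0(\varphi,\psi)=\operatorname{tr}\bigl(\psi(\log\psi-\log\varphi)\bigr)\in[0,+\infty] \] if $\operatorname{supp}\psi\le\operatorname{supp}\varphi$, and $D_0(\varphi,\psi)=+\infty$ otherwise. Here $\operatorname{supp}\rho$ is the projection onto the closure of the range of $\rho$, and, with the spectral decompositions $\psi=\sum_s sE_s$ and $\varphi=\sum_t tF_t$, the trace is understood as $\sum_{s>0}\sum_{t>0}\operatorname{tr}(E_sF_t)\,s(\log s-\log t)$, a series whose negative parts have a finite sum. Let $n\in\mathbb N$, let $P_1,\dots,P_n$ be orthogonal projections on $H$ with $P_iP_j=\delta_{ij}P_i$ for all $i,j$ and $\sum_{i=1}^nP_i=1$, and put \[ \mathcal Q_{\mathrm L}=\{\omega\in\mathcal M : P_i\omega=\omega P_i\ \text{for all } i\in\{1,\dots,n\}\}. \] Then for every $\psi\in\mathcal M$ the function $\varphi\mapsto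 D_0(\varphi,\psi)$ has exactly one minimiser over $\mathcal Q_{\mathrm L}$, and it is given by the weak Lüders rule: \[ \operatorname*{arg\,inf}_{\varphi\in\mathcal Q_{\mathrm L}}D_0(\varphi,\psi)=\Bigl\{\sum_{i=1}^nP_i\psi P_i\Bigr\}. \] -/

import Mathlib

open scoped ENNReal InnerProductSpace

noncomputable section

namespace QEntropy

variable {H : Type*} [NormedAddCommGroup H] [InnerProductSpace ℂ H] [CompleteSpace H]

/-- The index set of an orthonormal (Hilbert) basis of `H`, chosen once and for all. -/
def basisIndex (H : Type*) [NormedAddCommGroup H] [InnerProductSpace ℂ H] [CompleteSpace H] :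
    Set H :=
  (exists_hilbertBasis ℂ H).choose

/-- An orthonormal (Hilbert) basis of `H`, chosen once and for all. -/
def basis (H : Type*) [NormedAddCommGroup H] [InnerProductSpace ℂ H] [CompleteSpace H] :
    HilbertBasis (basisIndex H) ℂ H :=
  (exists_hilbertBasis ℂ H).choose_spec.choose

/-- The trace `tr T = ∑ᵢ ⟨bᵢ, T bᵢ⟩ ∈ [0, ∞]` of a positive operator `T`, over an orthonormal
basis of `H`. It does not depend on the basis (`trace_eq_tsum`). It is used for positive operators
only; such an operator is trace class if and only if its trace is finite. -/
def trace (T : H →L[ℂ] H) : ℝ≥0∞ :=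
  ∑' i, ENNReal.ofReal (⟪basis H i, T (basis H i)⟫_ℂ).re

/-- Parseval's identity with values in `[0, ∞]`. -/
theorem tsum_parseval {ι : Type*} (b : HilbertBasis ι ℂ H) (x : H) :
    ∑' i, ENNReal.ofReal (‖⟪b i, x⟫_ℂ‖ ^ 2) = ENNReal.ofReal (‖x‖ ^ 2) := by
  have h := (b.hasSum_inner_mul_inner x x).mapL Complex.reCLM
  have h' : HasSum (fun i => ‖⟪b i, x⟫_ℂ‖ ^ 2) (‖x‖ ^ 2) := by
    convert h using 1
    · funext i
      have e := inner_mul_symm_re_eq_norm (𝕜 := ℂ) x (b i)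
      rw [norm_mul, norm_inner_symm x (b i), ← sq] at e
      exact e.symm
    · rw [Complex.reCLM_apply]
      exact (inner_self_eq_norm_sq (𝕜 := ℂ) x).symm
  rw [← ENNReal.ofReal_tsum_of_nonneg (fun i => sq_nonneg _) h'.summable, h'.tsum_eq]

/-- The trace of a positive operator can be computed in every orthonormal basis. -/
theorem trace_eq_tsum {T : H →L[ℂ] H} (hT : T.IsPositive) {ι : Type*} (b : HilbertBasis ι ℂ H) :
    trace T = ∑' i, ENNReal.ofReal (⟪b i, T (b i)⟫_ℂ).re := by
  have h0 : 0 ≤ T := (ContinuousLinearMap.nonneg_iff_isPositive T).2 hT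
  set S : H →L[ℂ] H := CFC.sqrt T with hS
  have hSS : S * S = T := CFC.sqrt_mul_sqrt_self T h0
  have hSpos : S.IsPositive :=
    (ContinuousLinearMap.nonneg_iff_isPositive S).1 (CFC.sqrt_nonneg T)
  have key : ∀ x : H, (⟪x, T x⟫_ℂ).re = ‖S x‖ ^ 2 := by
    intro x
    rw [← hSS, mul_apply_eq_comp, ← hSpos.inner_left_eq_inner_right]
    exact inner_self_eq_norm_sq (𝕜 := ℂ) (S x)
  unfold trace
  simp only [key]
  have e : ∀ i, ENNReal.ofReal (‖S (basis H i)‖ ^ 2) =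
      ∑' j, ENNReal.ofReal (‖⟪b j, S (basis H i)⟫_ℂ‖ ^ 2) := fun i => (tsum_parseval b _).symm
  simp only [e]
  rw [ENNReal.tsum_comm]
  refine tsum_congr fun j => ?_
  rw [← tsum_parseval (basis H)]
  refine tsum_congr fun i => ?_
  rw [← hSpos.inner_left_eq_inner_right, norm_inner_symm]

/-- The normal states of the algebra of all bounded operators on `H`, identified with the density
operators on `H`: the positive trace class operators of trace one. -/
def states (H : Type*) [NormedAddCommGroup H] [InnerProductSpace ℂ H] [CompleteSpace H] :
    Set (H →L[ℂ] H) :=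
  {ρ | ρ.IsPositive ∧ trace ρ = 1}

/-- The support of a positive operator, as a closed subspace: the closure of its range. -/
def support (T : H →L[ℂ] H) : Submodule ℂ H :=
  (LinearMap.range (T : H →ₗ[ℂ] H)).topologicalClosure

instance eigenspace_hasOrthogonalProjection (T : H →L[ℂ] H) (z : ℂ) :
    (Module.End.eigenspace (T : H →ₗ[ℂ] H) z).HasOrthogonalProjection := by
  have h : IsClosed (Module.End.eigenspace (T : H →ₗ[ℂ] H) z : Set H) := by
    have : (Module.End.eigenspace (T : H →ₗ[ℂ] H) z : Set H) = {x | T x = z • x} := by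
      ext x
      simp
    rw [this]
    exact isClosed_eq T.continuous (continuous_const_smul z)
  have := h.completeSpace_coe
  infer_instance

/-- The spectral projection of `T` at the real number `s`: the orthogonal projection onto the
kernel of `T - s`. A density operator has the spectral decomposition `ρ = ∑ s, s • eigenProj ρ s`,
and `log ρ = ∑ s, log s • eigenProj ρ s` on the support of `ρ`. -/
def eigenProj (T : H →L[ℂ] H) (s : ℝ) : H →L[ℂ] H :=
  (Module.End.eigenspace (T : H →ₗ[ℂ] H) (s : ℂ)).starProjection

/-- The number `tr (E_s F_t) = tr (E_s F_t E_s)`, where `E_s` and `F_t` are the spectral projections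
of `ψ` at `s` and of `φ` at `t`. -/
def overlap (ψ φ : H →L[ℂ] H) (s t : ℝ) : ℝ≥0∞ :=
  trace (eigenProj ψ s * eigenProj φ t * eigenProj ψ s)

/-- The trace `tr (ψ (log ψ - log φ))` for density operators `ψ`, `φ` such that the support of `ψ`
is contained in that of `φ`. Since the logarithms are unbounded operators in general, the trace is
taken in the spectral decompositions `ψ = ∑ s, s • E_s` and `φ = ∑ t, t • F_t`: it is
`∑ s, ∑ t, tr (E_s F_t) * (s * (log s - log t))`, evaluated as the sum of the positive parts
(possibly `∞`) minus the sum of the negative parts (at most `1` because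
`s * (log t - log s) ≤ t`). -/
def traceLog (ψ φ : H →L[ℂ] H) : EReal :=
  ((∑' (s : ℝ) (t : ℝ), overlap ψ φ s t *
      ENNReal.ofReal (s * (Real.log s - Real.log t)) : ℝ≥0∞) : EReal) -
  ((∑' (s : ℝ) (t : ℝ), overlap ψ φ s t *
      ENNReal.ofReal (-(s * (Real.log s - Real.log t))) : ℝ≥0∞) : EReal)

open Classical in
/-- The Umegaki distance `D₀(φ, ψ)` of density operators: `tr (ψ (log ψ - log φ))` if the support
of `ψ` is contained in the support of `φ`, and `+∞` otherwise. -/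
def umegaki (φ ψ : H →L[ℂ] H) : EReal :=
  if support ψ ≤ support φ then traceLog ψ φ else ⊤

/-- The set of minimisers over `Q` of the function `φ ↦ D φ ψ`. -/
def argInf {X : Type*} (D : X → X → EReal) (Q : Set X) (ψ : X) : Set X :=
  {φ | φ ∈ Q ∧ ∀ ω ∈ Q, D φ ψ ≤ D ω ψ}

/-- The density operators that commute with every `P i`. -/
def commutingStates {n : ℕ} (P : Fin n → (H →L[ℂ] H)) : Set (H →L[ℂ] H) :=
  {ω | ω ∈ states H ∧ ∀ i, P i * ω = ω * P i}

end QEntropy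

end

noncomputable section

namespace QEntropy

variable {H : Type*} [NormedAddCommGroup H] [InnerProductSpace ℂ H] [CompleteSpace H]

/-! Write `D(ψ‖φ)` for `umegaki φ ψ` and `ω = ∑ᵢ Pᵢ ψ Pᵢ`. If `φ` commutes with all `Pᵢ`, so do its
spectral projections `F_t`, whence `tr (ω F_t) = tr (ψ F_t)` and formally `tr (ω log φ) = tr (ψ log
φ)`. Since `ω` itself commutes with all `Pᵢ`, also `tr (ω log ω) = tr (ψ log ω)`. Together these
give the Pythagorean identity `D(ψ‖φ) = D(ψ‖ω) + D(ω‖φ)` (`overlapSum_pythagorean`). Klein's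
inequality says `D(ω‖φ) ≥ 0`, with equality only for `φ = ω` (`overlapSum_negLog_le_posLog`,
`eq_of_overlapSum_eq`).

Two points need care in infinite dimension. The entropies may be infinite, so the identity is proved
for truncated logarithms, with positive and negative parts on opposite sides in `[0, ∞]`, and passes
to the limit by monotone convergence. Uniqueness needs `D(ψ‖ω) < ∞`; this follows from the pinching
inequality `ψ ≤ n ω` (`overlapSum_posLog_ne_top`). -/

/-! ### Hilbert–Schmidt norms and compactness of density operators. -/

/-- The square of the Hilbert–Schmidt norm, `∑ᵢ ‖A bᵢ‖² ∈ [0, ∞]`. -/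
def hsSq (A : H →L[ℂ] H) : ℝ≥0∞ :=
  ∑' i, ENNReal.ofReal (‖A (basis H i)‖ ^ 2)

/-- By Parseval both sides are the double sum of the squared matrix entries. This replaces cyclicity
of the trace throughout. -/
theorem hsSq_eq_of_adjoint {A B : H →L[ℂ] H} (h : ∀ x y, ⟪A x, y⟫_ℂ = ⟪x, B y⟫_ℂ) :
    hsSq A = hsSq B := by
  unfold hsSq
  have e : ∀ i, ENNReal.ofReal (‖A (basis H i)‖ ^ 2) =
      ∑' j, ENNReal.ofReal (‖⟪basis H j, A (basis H i)⟫_ℂ‖ ^ 2) :=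
    fun i => (tsum_parseval (basis H) _).symm
  simp only [e]
  rw [ENNReal.tsum_comm]
  refine tsum_congr fun j => ?_
  rw [← tsum_parseval (basis H)]
  refine tsum_congr fun i => ?_
  rw [← h, norm_inner_symm]

theorem ofReal_norm_sq_le_hsSq (A : H →L[ℂ] H) (x : H) :
    ENNReal.ofReal (‖A x‖ ^ 2) ≤ hsSq A * ENNReal.ofReal (‖x‖ ^ 2) := by
  have hA : hsSq A = hsSq (ContinuousLinearMap.adjoint A) :=
    hsSq_eq_of_adjoint fun x y => (ContinuousLinearMap.adjoint_inner_right A x y).symm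
  rw [hA, hsSq, ← ENNReal.tsum_mul_right, ← tsum_parseval (basis H)]
  refine ENNReal.tsum_le_tsum fun i => ?_
  rw [← ENNReal.ofReal_mul (by positivity), ← mul_pow,
    ← ContinuousLinearMap.adjoint_inner_left]
  exact ENNReal.ofReal_le_ofReal (pow_le_pow_left₀ (norm_nonneg _) (norm_inner_le_norm _ _) 2)

theorem hsSq_eq_zero {A : H →L[ℂ] H} : hsSq A = 0 ↔ A = 0 := by
  constructor
  · intro h
    ext x
    have := ofReal_norm_sq_le_hsSq A x
    rw [h, zero_mul, nonpos_iff_eq_zero, ENNReal.ofReal_eq_zero] at this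
    simpa using le_antisymm this (by positivity)
  · rintro rfl
    simp [hsSq]

/-- `A` is the norm limit of its restrictions to spans of finitely many basis vectors: the squared
norm of the error is at most a tail of the convergent series `hsSq A`. -/
theorem isCompactOperator_of_hsSq_ne_top {A : H →L[ℂ] H} (hA : hsSq A ≠ ⊤) :
    IsCompactOperator A := by
  set b := basis H
  let K : Finset (basisIndex H) → Submodule ℂ H := fun F =>
    Submodule.span ℂ (b '' (F : Set (basisIndex H)))
  have hfin : ∀ F, FiniteDimensional ℂ (K F) := fun F =>
    FiniteDimensional.span_of_finite ℂ (F.finite_toSet.image _)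
  have hcomp : ∀ F, IsCompactOperator (A * (K F).starProjection) := by
    intro F
    have := FiniteDimensional.proper ℂ (K F)
    exact (isCompactOperator_of_locallyCompactSpace_dom
      ((K F).orthogonalProjectionOnto)).clm_comp (A ∘L (K F).subtypeL)
  refine isCompactOperator_of_tendsto (l := Filter.atTop)
    (F := fun F => A * (K F).starProjection) ?_ (Filter.Eventually.of_forall hcomp)
  have hb : ∀ F, ENNReal.ofReal (‖A * (K F).starProjection - A‖ ^ 2) ≤
      ∑' i : {i // i ∉ F}, ENNReal.ofReal (‖A (b i)‖ ^ 2) := by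
    intro F
    have hs : hsSq (A * (K F).starProjection - A) =
        ∑' i : {i // i ∉ F}, ENNReal.ofReal (‖A (b i)‖ ^ 2) := by
      rw [hsSq]
      rw [show (∑' i : {i // i ∉ F}, ENNReal.ofReal (‖A (b i)‖ ^ 2)) = _ from
        tsum_subtype {i | i ∉ F} fun i => ENNReal.ofReal (‖A (b i)‖ ^ 2)]
      refine tsum_congr fun i => ?_
      by_cases hi : i ∈ F
      · have h1 : (K F).starProjection (b i) = b i :=
          Submodule.starProjection_eq_self_iff.2
            (Submodule.subset_span ⟨i, by simpa using hi, rfl⟩)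
        have hi' : i ∉ {i | i ∉ F} := not_not.2 hi
        rw [Set.indicator_of_notMem hi']
        change ENNReal.ofReal (‖A ((K F).starProjection (b i)) - A (b i)‖ ^ 2) = _
        rw [h1]
        simp
      · have h1 : (K F).starProjection (b i) = 0 := by
          rw [Submodule.starProjection_apply_eq_zero_iff, Submodule.mem_orthogonal]
          intro u hu
          induction hu using Submodule.span_induction with
          | mem x hx =>
            obtain ⟨j, hj, rfl⟩ := hx
            exact b.orthonormal.2 (by rintro rfl; exact hi (by simpa using hj))
          | zero => simp
          | add x y _ _ hx hy => rw [inner_add_left, hx, hy, add_zero]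
          | smul a x _ hx => rw [inner_smul_left, hx, mul_zero]
        have hi' : i ∈ {i | i ∉ F} := hi
        rw [Set.indicator_of_mem hi']
        change ENNReal.ofReal (‖A ((K F).starProjection (b i)) - A (b i)‖ ^ 2) = _
        rw [h1]
        simp
    rw [← hs]
    by_cases htop : hsSq (A * (K F).starProjection - A) = ⊤
    · simp [htop]
    refine ENNReal.ofReal_le_of_le_toReal ?_
    rw [← Real.sq_sqrt (ENNReal.toReal_nonneg (a := hsSq (A * (K F).starProjection - A)))]
    refine pow_le_pow_left₀ (norm_nonneg _) ?_ 2
    refine ContinuousLinearMap.opNorm_le_bound _ (Real.sqrt_nonneg _) fun x => ?_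
    refine le_of_sq_le_sq ?_ (by positivity)
    rw [mul_pow, Real.sq_sqrt ENNReal.toReal_nonneg]
    have := ofReal_norm_sq_le_hsSq (A * (K F).starProjection - A) x
    rw [← ENNReal.ofReal_toReal htop, ← ENNReal.ofReal_mul ENNReal.toReal_nonneg,
      ENNReal.ofReal_le_ofReal_iff (by positivity)] at this
    exact this
  have h0 := tendsto_of_tendsto_of_tendsto_of_le_of_le tendsto_const_nhds
    (ENNReal.tendsto_tsum_compl_atTop_zero hA) (fun _ => zero_le) hb
  have h1 := (ENNReal.tendsto_toReal ENNReal.zero_ne_top).comp h0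
  have h2 : Filter.Tendsto (fun F => ‖A * (K F).starProjection - A‖ ^ 2) Filter.atTop
      (nhds 0) := by
    refine h1.congr fun F => ?_
    simp only [Function.comp]
    rw [ENNReal.toReal_ofReal (by positivity)]
  rw [tendsto_iff_norm_sub_tendsto_zero]
  have h3 := h2.sqrt
  simpa [Real.sqrt_sq] using h3

/-- A positive operator is the square of a symmetric operator. -/
theorem exists_sqrt {T : H →L[ℂ] H} (hT : T.IsPositive) :
    ∃ S : H →L[ℂ] H, S * S = T ∧ (∀ x y, ⟪S x, y⟫_ℂ = ⟪x, S y⟫_ℂ) ∧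
      ∀ x, (⟪x, T x⟫_ℂ).re = ‖S x‖ ^ 2 := by
  have h0 : 0 ≤ T := (ContinuousLinearMap.nonneg_iff_isPositive T).2 hT
  have hSS : CFC.sqrt T * CFC.sqrt T = T := CFC.sqrt_mul_sqrt_self T h0
  have hSpos : (CFC.sqrt T).IsPositive :=
    (ContinuousLinearMap.nonneg_iff_isPositive _).1 (CFC.sqrt_nonneg T)
  refine ⟨CFC.sqrt T, hSS, fun x y => hSpos.inner_left_eq_inner_right x y, fun x => ?_⟩
  conv_lhs => rw [← hSS, mul_apply_eq_comp, ← hSpos.inner_left_eq_inner_right]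
  exact inner_self_eq_norm_sq (𝕜 := ℂ) _

theorem isCompactOperator_of_mem_states {ρ : H →L[ℂ] H} (hρ : ρ ∈ states H) :
    IsCompactOperator ρ := by
  obtain ⟨S, hSS, -, hS⟩ := exists_sqrt hρ.1
  have h : hsSq S = 1 := by
    rw [← hρ.2]
    exact tsum_congr fun i => by rw [hS]
  have hc : IsCompactOperator S := isCompactOperator_of_hsSq_ne_top (by simp [h])
  rw [← hSS]
  exact hc.comp_clm S

/-! ### Spectral decomposition of a density operator. -/

theorem apply_eigenProj (T : H →L[ℂ] H) (s : ℝ) (x : H) :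
    T (eigenProj T s x) = (s : ℂ) • eigenProj T s x :=
  Module.End.mem_eigenspace_iff.1
    (Submodule.starProjection_apply_mem (Module.End.eigenspace (T : H →ₗ[ℂ] H) (s : ℂ)) x)

theorem eigenProj_apply_of_eq {T : H →L[ℂ] H} {s : ℝ} {x : H} (hx : T x = (s : ℂ) • x) :
    eigenProj T s x = x :=
  Submodule.starProjection_eq_self_iff.2 (Module.End.mem_eigenspace_iff.2 hx)

theorem eigenProj_idem (T : H →L[ℂ] H) (s : ℝ) (x : H) :
    eigenProj T s (eigenProj T s x) = eigenProj T s x :=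
  eigenProj_apply_of_eq (apply_eigenProj T s x)

theorem inner_eigenProj_left (T : H →L[ℂ] H) (s : ℝ) (x y : H) :
    ⟪eigenProj T s x, y⟫_ℂ = ⟪x, eigenProj T s y⟫_ℂ :=
  Submodule.inner_starProjection_left_eq_right _ x y

theorem inner_eigenProj_self (T : H →L[ℂ] H) (s : ℝ) (x : H) :
    ⟪x, eigenProj T s x⟫_ℂ = ((‖eigenProj T s x‖ ^ 2 : ℝ) : ℂ) := by
  rw [← eigenProj_idem, ← inner_eigenProj_left, inner_self_eq_norm_sq_to_K, eigenProj_idem]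
  norm_cast

theorem eigenProj_apply_eigenProj {T : H →L[ℂ] H} (hT : T.IsPositive) {s t : ℝ} (h : s ≠ t)
    (x : H) : eigenProj T s (eigenProj T t x) = 0 := by
  refine Submodule.starProjection_apply_eq_zero_iff _ |>.2 ?_
  rw [Submodule.mem_orthogonal]
  intro u hu
  have := hT.isSymmetric.orthogonalFamily_eigenspaces
    (i := (s : ℂ)) (j := (t : ℂ)) (by exact_mod_cast h) ⟨u, hu⟩
    ⟨eigenProj T t x, Module.End.mem_eigenspace_iff.2 (apply_eigenProj T t x)⟩
  simpa using this

theorem eigenProj_of_neg {T : H →L[ℂ] H} (hT : T.IsPositive) {s : ℝ} (hs : s < 0) :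
    eigenProj T s = 0 := by
  ext x
  have h := hT.re_inner_nonneg_right (eigenProj T s x)
  rw [apply_eigenProj, inner_smul_right, inner_self_eq_norm_sq_to_K] at h
  have h' : 0 ≤ s * ‖eigenProj T s x‖ ^ 2 := by
    have e : ((s : ℂ) * ((‖eigenProj T s x‖ : ℂ)) ^ 2) =
      ((s * ‖eigenProj T s x‖ ^ 2 : ℝ) : ℂ) := by push_cast; rfl
    rw [← Complex.ofReal_re (s * ‖eigenProj T s x‖ ^ 2), ← e]
    exact h
  have h2 : ‖eigenProj T s x‖ ^ 2 ≤ 0 := by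
    by_contra hc
    push Not at hc
    nlinarith
  simpa using le_antisymm h2 (by positivity)

/-- The spectral theorem for compact symmetric operators; real indices suffice because all
eigenvalues are real. -/
theorem hasSum_eigenProj {ρ : H →L[ℂ] H} (hρ : ρ ∈ states H) (x : H) :
    HasSum (fun s : ℝ => eigenProj ρ s x) x := by
  have hsymm := hρ.1.isSymmetric
  have hF := hsymm.orthogonalFamily_eigenspaces.comp Complex.ofReal_injective
  have hbot := ContinuousLinearMap.orthogonalComplement_iSup_eigenspaces_eq_bot
    (isCompactOperator_of_mem_states hρ) hsymm
  have hle : (⨆ μ, Module.End.eigenspace (ρ : H →ₗ[ℂ] H) μ) ≤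
      ⨆ s : ℝ, Module.End.eigenspace (ρ : H →ₗ[ℂ] H) (s : ℂ) := by
    refine iSup_le fun μ => ?_
    by_cases hμ : Module.End.HasEigenvalue (ρ : H →ₗ[ℂ] H) μ
    · have := Complex.conj_eq_iff_real.1 (hsymm.conj_eigenvalue_eq_self hμ)
      obtain ⟨s, rfl⟩ := this
      exact le_iSup (fun s : ℝ => Module.End.eigenspace (ρ : H →ₗ[ℂ] H) (s : ℂ)) s
    · rw [Module.End.hasEigenvalue_iff, not_not] at hμ
      rw [hμ]
      exact bot_le
  have hcs : ∀ s : ℝ, CompleteSpace (Module.End.eigenspace (ρ : H →ₗ[ℂ] H) (s : ℂ)) := by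
    intro s
    have : IsClosed (Module.End.eigenspace (ρ : H →ₗ[ℂ] H) (s : ℂ) : Set H) := by
      have e : (Module.End.eigenspace (ρ : H →ₗ[ℂ] H) (s : ℂ) : Set H) =
          {x | ρ x = (s : ℂ) • x} := by
        ext x
        simp
      rw [e]
      exact isClosed_eq ρ.continuous (continuous_const_smul _)
    exact this.completeSpace_coe
  have hH : IsHilbertSum ℂ (fun s : ℝ => Module.End.eigenspace (ρ : H →ₗ[ℂ] H) (s : ℂ))
      fun s => (Module.End.eigenspace (ρ : H →ₗ[ℂ] H) (s : ℂ)).subtypeₗᵢ := by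
    refine IsHilbertSum.mkInternal _ hF ?_
    rw [top_le_iff, Submodule.topologicalClosure_eq_top_iff, eq_bot_iff, ← hbot]
    exact Submodule.orthogonal_le hle
  have hs := hH.hasSum_linearIsometryEquiv_symm (hH.linearIsometryEquiv x)
  rw [LinearIsometryEquiv.symm_apply_apply] at hs
  convert hs using 2 with s
  -- The projection at `s` kills every other component of the expansion, so the component at `s` is
  -- the projection of `x`.
  have h1 := hs.mapL (eigenProj ρ s)
  have hmem : ∀ t, ρ ((hH.linearIsometryEquiv x) t : H) =
      (t : ℂ) • ((hH.linearIsometryEquiv x) t : H) := fun t =>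
    Module.End.mem_eigenspace_iff.1 ((hH.linearIsometryEquiv x) t).2
  have h2 := hasSum_single (f := fun t : ℝ => eigenProj ρ s
    ((Module.End.eigenspace (ρ : H →ₗ[ℂ] H) (t : ℂ)).subtypeₗᵢ ((hH.linearIsometryEquiv x) t))) s
    (by
      intro t ht
      change eigenProj ρ s ((hH.linearIsometryEquiv x) t : H) = 0
      rw [← eigenProj_apply_of_eq (hmem t)]
      exact eigenProj_apply_eigenProj hρ.1 ht.symm _)
  rw [h1.unique h2]
  exact eigenProj_apply_of_eq (hmem s)

theorem tsum_norm_sq_eigenProj {ρ : H →L[ℂ] H} (hρ : ρ ∈ states H) (x : H) :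
    ∑' s : ℝ, ENNReal.ofReal (‖eigenProj ρ s x‖ ^ 2) = ENNReal.ofReal (‖x‖ ^ 2) := by
  have h := ((hasSum_eigenProj hρ x).mapL (innerSL ℂ x)).mapL Complex.reCLM
  simp only [innerSL_apply_apply, inner_eigenProj_self, Complex.reCLM_apply, Complex.ofReal_re]
    at h
  rw [← ENNReal.ofReal_tsum_of_nonneg (fun s => by positivity) h.summable, h.tsum_eq]
  congr 1
  exact inner_self_eq_norm_sq (𝕜 := ℂ) x

theorem tsum_mul_norm_sq_eigenProj {ρ : H →L[ℂ] H} (hρ : ρ ∈ states H) (x : H) :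
    ∑' s : ℝ, ENNReal.ofReal s * ENNReal.ofReal (‖eigenProj ρ s x‖ ^ 2) =
      ENNReal.ofReal (⟪x, ρ x⟫_ℂ).re := by
  have h := (((hasSum_eigenProj hρ x).mapL ρ).mapL (innerSL ℂ x)).mapL Complex.reCLM
  simp only [innerSL_apply_apply, apply_eigenProj, inner_smul_right, inner_eigenProj_self,
    Complex.reCLM_apply, ← Complex.ofReal_mul, Complex.ofReal_re] at h
  rw [← h.tsum_eq, ENNReal.ofReal_tsum_of_nonneg _ h.summable]
  · refine tsum_congr fun s => ?_
    rw [ENNReal.ofReal_mul' (by positivity)]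
  · intro s
    rcases lt_or_ge s 0 with hs | hs
    · simp [eigenProj_of_neg hρ.1 hs]
    · positivity

/-! ### Overlaps of spectral projections and their marginals. -/

/-- The trace of `A* ρ A` for a positive operator `ρ`. -/
def conjTrace (ρ A : H →L[ℂ] H) : ℝ≥0∞ :=
  ∑' i, ENNReal.ofReal (⟪A (basis H i), ρ (A (basis H i))⟫_ℂ).re

theorem conjTrace_one (ρ : H →L[ℂ] H) : conjTrace ρ 1 = trace ρ := rfl

theorem conjTrace_eigenProj (ρ : H →L[ℂ] H) (s : ℝ) :
    conjTrace ρ (eigenProj ρ s) = ENNReal.ofReal s * hsSq (eigenProj ρ s) := by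
  rw [conjTrace, hsSq, ← ENNReal.tsum_mul_left]
  refine tsum_congr fun i => ?_
  rw [apply_eigenProj, inner_smul_right, ← ENNReal.ofReal_mul' (by positivity)]
  congr 1
  rw [inner_self_eq_norm_sq_to_K, Complex.re_ofReal_mul]
  congr 1
  norm_cast

/-- `E F E = (F E)* (F E)` for projections `E` and `F`. -/
theorem overlap_eq_hsSq (ψ φ : H →L[ℂ] H) (s t : ℝ) :
    overlap ψ φ s t = hsSq (eigenProj φ t * eigenProj ψ s) := by
  refine tsum_congr fun i => ?_
  congr 1
  rw [mul_apply_eq_comp, mul_apply_eq_comp, mul_apply_eq_comp, ← inner_eigenProj_left,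
    inner_eigenProj_self, Complex.ofReal_re]

theorem overlap_comm (ψ φ : H →L[ℂ] H) (s t : ℝ) : overlap ψ φ s t = overlap φ ψ t s := by
  rw [overlap_eq_hsSq, overlap_eq_hsSq]
  refine hsSq_eq_of_adjoint fun x y => ?_
  rw [mul_apply_eq_comp, mul_apply_eq_comp, inner_eigenProj_left, inner_eigenProj_left]

theorem overlap_of_neg_left {ψ : H →L[ℂ] H} (hψ : ψ.IsPositive) (φ : H →L[ℂ] H) {s : ℝ}
    (hs : s < 0) (t : ℝ) : overlap ψ φ s t = 0 := by
  rw [overlap_eq_hsSq, eigenProj_of_neg hψ hs, mul_zero, hsSq_eq_zero]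

theorem overlap_of_neg_right (ψ : H →L[ℂ] H) {φ : H →L[ℂ] H} (hφ : φ.IsPositive) (s : ℝ)
    {t : ℝ} (ht : t < 0) : overlap ψ φ s t = 0 := by
  rw [overlap_comm, overlap_of_neg_left hφ ψ ht]

theorem tsum_overlap_right (ψ : H →L[ℂ] H) {φ : H →L[ℂ] H} (hφ : φ ∈ states H) (s : ℝ) :
    ∑' t, overlap ψ φ s t = hsSq (eigenProj ψ s) := by
  simp only [overlap_eq_hsSq, hsSq]
  rw [ENNReal.tsum_comm]
  exact tsum_congr fun i => tsum_norm_sq_eigenProj hφ _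

/-- `ψ = ∑ s E_s`, so the weighted marginal is `tr (F_t ψ F_t)`; `ψ` enters `tr (ψ log φ)` only
through these numbers. -/
theorem tsum_mul_overlap_left {ψ : H →L[ℂ] H} (hψ : ψ ∈ states H) (φ : H →L[ℂ] H) (t : ℝ) :
    ∑' s, overlap ψ φ s t * ENNReal.ofReal s = conjTrace ψ (eigenProj φ t) := by
  simp only [overlap_comm ψ φ, overlap_eq_hsSq, hsSq, ← ENNReal.tsum_mul_right]
  rw [ENNReal.tsum_comm]
  refine tsum_congr fun i => (tsum_congr fun s => mul_comm _ _).trans ?_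
  exact tsum_mul_norm_sq_eigenProj hψ _

theorem tsum_mul_hsSq {ψ : H →L[ℂ] H} (hψ : ψ ∈ states H) :
    ∑' s, ENNReal.ofReal s * hsSq (eigenProj ψ s) = 1 := by
  simp only [hsSq, ← ENNReal.tsum_mul_left]
  rw [ENNReal.tsum_comm, ← hψ.2]
  exact tsum_congr fun i => tsum_mul_norm_sq_eigenProj hψ _

theorem tsum_tsum_overlap_mul_left {ψ φ : H →L[ℂ] H} (hψ : ψ ∈ states H) (hφ : φ ∈ states H) :
    ∑' (s : ℝ) (t : ℝ), overlap ψ φ s t * ENNReal.ofReal s = 1 := by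
  simp only [ENNReal.tsum_mul_right, tsum_overlap_right ψ hφ]
  rw [← tsum_mul_hsSq hψ]
  exact tsum_congr fun s => mul_comm _ _

theorem tsum_tsum_overlap_mul_right {ψ φ : H →L[ℂ] H} (hψ : ψ ∈ states H) (hφ : φ ∈ states H) :
    ∑' (s : ℝ) (t : ℝ), overlap ψ φ s t * ENNReal.ofReal t = 1 := by
  rw [ENNReal.tsum_comm]
  simp only [overlap_comm ψ φ]
  exact tsum_tsum_overlap_mul_left hφ hψ

theorem conjTrace_eq_hsSq {ρ S : H →L[ℂ] H} (hS : ∀ x, (⟪x, ρ x⟫_ℂ).re = ‖S x‖ ^ 2)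
    (A : H →L[ℂ] H) : conjTrace ρ A = hsSq (S * A) :=
  tsum_congr fun i => by rw [hS]; rfl

/-! ### The Lüders state and the pinching inequality. -/

section Luders

variable {n : ℕ} {P : Fin n → (H →L[ℂ] H)}

/-- The weak Lüders rule `ψ ↦ ∑ᵢ Pᵢ ψ Pᵢ`. -/
def luders (P : Fin n → (H →L[ℂ] H)) (ψ : H →L[ℂ] H) : H →L[ℂ] H :=
  ∑ i, P i * ψ * P i

theorem luders_apply (P : Fin n → (H →L[ℂ] H)) (ψ : H →L[ℂ] H) (x : H) :
    luders P ψ x = ∑ i, P i (ψ (P i x)) := by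
  simp [luders, mul_apply_eq_comp]

theorem inner_projection_left (hP : ∀ i, IsStarProjection (P i)) (i : Fin n) (x y : H) :
    ⟪P i x, y⟫_ℂ = ⟪x, P i y⟫_ℂ :=
  (hP i).isSelfAdjoint.isSymmetric x y

theorem sum_projection_apply (hsum : ∑ i, P i = 1) (x : H) : ∑ i, P i x = x := by
  have := congrArg (fun T : H →L[ℂ] H => T x) hsum
  simpa using this

theorem sum_norm_sq_projection (hP : ∀ i, IsStarProjection (P i)) (hsum : ∑ i, P i = 1) (x : H) :
    ∑ i, ‖P i x‖ ^ 2 = ‖x‖ ^ 2 := by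
  have h : ∀ i, ‖P i x‖ ^ 2 = (⟪x, P i x⟫_ℂ).re := by
    intro i
    have e : P i (P i x) = P i x := congrArg (fun T : H →L[ℂ] H => T x) (hP i).isIdempotentElem.eq
    rw [← e, ← inner_projection_left hP, e]
    exact (inner_self_eq_norm_sq (𝕜 := ℂ) _).symm
  simp only [h, ← Complex.re_sum, ← inner_sum, sum_projection_apply hsum]
  exact inner_self_eq_norm_sq (𝕜 := ℂ) _

theorem inner_luders (hP : ∀ i, IsStarProjection (P i)) (ψ : H →L[ℂ] H) (x : H) :
    (⟪x, luders P ψ x⟫_ℂ).re = ∑ i, (⟪P i x, ψ (P i x)⟫_ℂ).re := by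
  simp only [luders_apply, inner_sum, Complex.re_sum, inner_projection_left hP]

/-- With `S = √ψ` the left side is `∑ⱼ ‖S Pⱼ A‖²` in Hilbert–Schmidt norm. Commuting `Pⱼ` past `A`
and taking adjoints turns it into `∑ⱼ ‖Pⱼ A S‖² = ‖A S‖² = ‖S A‖²`. -/
theorem conjTrace_luders (hP : ∀ i, IsStarProjection (P i)) (hsum : ∑ i, P i = 1)
    {ψ : H →L[ℂ] H} (hψ : ψ.IsPositive) {A : H →L[ℂ] H}
    (hA : ∀ x y, ⟪A x, y⟫_ℂ = ⟪x, A y⟫_ℂ) (hPA : ∀ i, P i * A = A * P i) :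
    conjTrace (luders P ψ) A = conjTrace ψ A := by
  obtain ⟨S, -, hSs, hS⟩ := exists_sqrt hψ
  have h1 : conjTrace (luders P ψ) A = ∑ j, hsSq (S * (P j * A)) := by
    simp only [conjTrace, hsSq]
    rw [← Summable.tsum_finsetSum fun _ _ => ENNReal.summable]
    refine tsum_congr fun i => ?_
    rw [inner_luders hP, ENNReal.ofReal_sum_of_nonneg fun j _ => by rw [hS]; positivity]
    exact Finset.sum_congr rfl fun j _ => by rw [hS]; rfl
  have h2 : ∀ j, hsSq (S * (P j * A)) = hsSq (P j * (A * S)) := by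
    intro j
    rw [hPA]
    refine hsSq_eq_of_adjoint fun x y => ?_
    simp only [mul_apply_eq_comp]
    rw [hSs, hA, inner_projection_left hP]
  have h3 : ∑ j, hsSq (P j * (A * S)) = hsSq (A * S) := by
    simp only [hsSq]
    rw [← Summable.tsum_finsetSum fun _ _ => ENNReal.summable]
    refine tsum_congr fun i => ?_
    rw [← sum_norm_sq_projection hP hsum, ENNReal.ofReal_sum_of_nonneg fun j _ => by positivity]
    rfl
  rw [h1, Finset.sum_congr rfl fun j _ => h2 j, h3, conjTrace_eq_hsSq hS]
  refine hsSq_eq_of_adjoint fun x y => ?_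
  simp only [mul_apply_eq_comp]
  rw [hA, hSs]

theorem luders_isPositive (hP : ∀ i, IsStarProjection (P i)) {ψ : H →L[ℂ] H}
    (hψ : ψ.IsPositive) : (luders P ψ).IsPositive := by
  refine ContinuousLinearMap.isPositive_sum _ fun i _ => ?_
  have := hψ.conj_adjoint (P i)
  rw [(hP i).isSelfAdjoint.adjoint_eq] at this
  exact this

theorem luders_mem_commutingStates (hP : ∀ i, IsStarProjection (P i))
    (hPP : ∀ i j, P i * P j = if i = j then P i else 0) (hsum : ∑ i, P i = 1)
    {ψ : H →L[ℂ] H} (hψ : ψ ∈ states H) : luders P ψ ∈ commutingStates P := by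
  refine ⟨⟨luders_isPositive hP hψ.1, ?_⟩, fun j => ?_⟩
  · rw [← conjTrace_one, conjTrace_luders hP hsum hψ.1 (fun x y => rfl) (fun i => by simp),
      conjTrace_one, hψ.2]
  · rw [luders, Finset.mul_sum, Finset.sum_mul]
    refine Finset.sum_congr rfl fun i _ => ?_
    rw [mul_assoc _ (P i) (P j), hPP i j, ← mul_assoc, ← mul_assoc, hPP j i]
    rcases eq_or_ne i j with rfl | h
    · simp
    · simp [h, h.symm]

/-- `Pᵢ` preserves the eigenspaces of `φ`, so `F Pᵢ F = Pᵢ F`; the adjoint of this is `F Pᵢ F = F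
Pᵢ`. -/
theorem projection_mul_eigenProj (hP : ∀ i, IsStarProjection (P i)) {φ : H →L[ℂ] H}
    (hφ : φ ∈ commutingStates P) (t : ℝ) (i : Fin n) :
    P i * eigenProj φ t = eigenProj φ t * P i := by
  have hc : ∀ x, φ (P i x) = P i (φ x) := fun x =>
    congrArg (fun T : H →L[ℂ] H => T x) (hφ.2 i).symm
  have h : ∀ x, eigenProj φ t (P i (eigenProj φ t x)) = P i (eigenProj φ t x) := fun x =>
    eigenProj_apply_of_eq (by rw [hc, apply_eigenProj, map_smul])
  ext x
  refine ext_inner_right ℂ fun y => ?_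
  simp only [mul_apply_eq_comp]
  rw [← h, inner_eigenProj_left, inner_projection_left hP, inner_eigenProj_left, h,
    inner_eigenProj_left, inner_projection_left hP]

theorem conjTrace_eigenProj_luders (hP : ∀ i, IsStarProjection (P i)) (hsum : ∑ i, P i = 1)
    {ψ : H →L[ℂ] H} (hψ : ψ.IsPositive) {φ : H →L[ℂ] H} (hφ : φ ∈ commutingStates P) (t : ℝ) :
    conjTrace (luders P ψ) (eigenProj φ t) = conjTrace ψ (eigenProj φ t) :=
  conjTrace_luders hP hsum hψ (inner_eigenProj_left φ t) (projection_mul_eigenProj hP hφ t)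

/-- The pinching inequality `ψ ≤ n ∑ᵢ Pᵢ ψ Pᵢ`. -/
theorem inner_le_card_mul_inner_luders (hP : ∀ i, IsStarProjection (P i)) (hsum : ∑ i, P i = 1)
    {ψ : H →L[ℂ] H} (hψ : ψ.IsPositive) (x : H) :
    (⟪x, ψ x⟫_ℂ).re ≤ n * (⟪x, luders P ψ x⟫_ℂ).re := by
  obtain ⟨S, -, -, hS⟩ := exists_sqrt hψ
  simp only [inner_luders hP, hS]
  have h1 : ‖S x‖ ≤ ∑ i, ‖S (P i x)‖ := by
    conv_lhs => rw [← sum_projection_apply hsum x, map_sum]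
    exact norm_sum_le _ _
  -- The factor `n` comes from Cauchy–Schwarz on the `n` summands.
  calc ‖S x‖ ^ 2 ≤ (∑ i, ‖S (P i x)‖) ^ 2 := pow_le_pow_left₀ (norm_nonneg _) h1 2
    _ ≤ n * ∑ i, ‖S (P i x)‖ ^ 2 := by
      simpa using sq_sum_le_card_mul_sum_sq (s := Finset.univ) (f := fun i => ‖S (P i x)‖)

end Luders

/-! ### Truncated logarithms and monotone convergence. -/

theorem tendsto_tsum_of_monotone {α : Type*} {f : ℕ → α → ℝ≥0∞} {g : α → ℝ≥0∞}
    (hf : ∀ a, Monotone fun k => f k a)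
    (hg : ∀ a, Filter.Tendsto (fun k => f k a) Filter.atTop (nhds (g a))) :
    Filter.Tendsto (fun k => ∑' a, f k a) Filter.atTop (nhds (∑' a, g a)) := by
  have hsup : ∀ a, g a = ⨆ k, f k a := fun a =>
    tendsto_nhds_unique (hg a) (tendsto_atTop_iSup (hf a))
  have h : ∑' a, g a = ⨆ k, ∑' a, f k a := by
    simp only [ENNReal.tsum_eq_iSup_sum, hsup]
    rw [iSup_comm]
    exact iSup_congr fun F => ENNReal.finsetSum_iSup_of_monotone hf
  rw [h]
  exact tendsto_atTop_iSup fun k l hkl => ENNReal.tsum_le_tsum fun a => hf a hkl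

/-- The logarithm, truncated to `[-k, k]`, with the value `-k` at `0`. -/
def clampLog (k : ℕ) (x : ℝ) : ℝ :=
  if x ≤ 0 then -k else max (-k) (min k (Real.log x))

theorem clampLog_le (k : ℕ) (x : ℝ) : clampLog k x ≤ k := by
  unfold clampLog
  have : (0 : ℝ) ≤ k := k.cast_nonneg
  split_ifs
  · linarith
  · exact max_le (by linarith) (min_le_left _ _)

theorem neg_le_clampLog (k : ℕ) (x : ℝ) : -(k : ℝ) ≤ clampLog k x := by
  unfold clampLog
  split_ifs
  · exact le_rfl
  · exact le_max_left _ _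

theorem clampLog_clampLog {k l : ℕ} (hkl : k ≤ l) (x : ℝ) :
    clampLog k x = max (-(k : ℝ)) (min (k : ℝ) (clampLog l x)) := by
  have h1 : (k : ℝ) ≤ l := by exact_mod_cast hkl
  have h0 : (0 : ℝ) ≤ k := k.cast_nonneg
  unfold clampLog
  split_ifs
  · rw [min_eq_right (by linarith), max_eq_left (by linarith)]
  · generalize Real.log x = a
    rw [max_min_distrib_left, max_min_distrib_left, max_eq_right (by linarith : -(k : ℝ) ≤ k),
      ← max_assoc, max_eq_left (by linarith : -(l : ℝ) ≤ -k), max_min_distrib_left,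
      max_eq_right (by linarith : -(k : ℝ) ≤ l), ← min_assoc, min_eq_left h1]

/-- Truncation at `k` factors through truncation at `l`, and clamping is monotone and nonexpansive.
Hence the positive part of a difference of truncated logarithms grows with `k`, as monotone
convergence requires. -/
theorem clampLog_sub_le {k l : ℕ} (hkl : k ≤ l) (x y : ℝ) :
    clampLog k x - clampLog k y ≤ max 0 (clampLog l x - clampLog l y) := by
  rw [clampLog_clampLog hkl x, clampLog_clampLog hkl y]
  generalize clampLog l x = a
  generalize clampLog l y = b
  rcases le_total a b with h | h
  · refine le_max_of_le_left (sub_nonpos.2 ?_)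
    gcongr
  · refine le_max_of_le_right ?_
    have h1 : min (k : ℝ) a ≤ min (k : ℝ) b + (a - b) := by
      rw [← min_add_add_right]
      exact min_le_min (by linarith) (by linarith)
    rw [sub_le_iff_le_add]
    refine max_le (by linarith [le_max_left (-(k : ℝ)) (min (k : ℝ) b)]) ?_
    linarith [le_max_right (-(k : ℝ)) (min (k : ℝ) b)]

theorem monotone_ofReal_clampLog {s : ℝ} (hs : 0 ≤ s) (x y : ℝ) :
    Monotone fun k : ℕ => ENNReal.ofReal (s * (clampLog k x - clampLog k y)) := by
  intro k l hkl
  have h := mul_le_mul_of_nonneg_left (clampLog_sub_le hkl x y) hs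
  refine (ENNReal.ofReal_le_ofReal h).trans ?_
  rcases le_total 0 (clampLog l x - clampLog l y) with h0 | h0
  · rw [max_eq_right h0]
  · rw [max_eq_left h0]
    simp

/-- The positive part of `s (log s - log t)` for `s, t ≥ 0`, equal to `∞` if `t = 0 < s`. -/
def posLog (s t : ℝ) : ℝ≥0∞ :=
  if t ≤ 0 ∧ 0 < s then ⊤ else ENNReal.ofReal (s * (Real.log s - Real.log t))

/-- The negative part of `s (log s - log t)` for `s, t ≥ 0`, equal to `0` if `t = 0`. -/
def negLog (s t : ℝ) : ℝ≥0∞ :=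
  if t ≤ 0 ∧ 0 < s then 0 else ENNReal.ofReal (s * (Real.log t - Real.log s))

theorem eventually_clampLog_eq {x : ℝ} (hx : 0 < x) :
    ∀ᶠ k : ℕ in Filter.atTop, clampLog k x = Real.log x := by
  obtain ⟨m, hm⟩ := exists_nat_ge |Real.log x|
  filter_upwards [Filter.eventually_ge_atTop m] with k hk
  have h : |Real.log x| ≤ k := hm.trans (by exact_mod_cast hk)
  rw [abs_le] at h
  rw [clampLog, if_neg hx.not_ge, min_eq_right h.2, max_eq_right h.1]

theorem clampLog_of_nonpos {x : ℝ} (hx : x ≤ 0) (k : ℕ) : clampLog k x = -k := if_pos hx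

theorem tendsto_posLog {s t : ℝ} (hs : 0 ≤ s) :
    Filter.Tendsto (fun k : ℕ => ENNReal.ofReal (s * (clampLog k s - clampLog k t)))
      Filter.atTop (nhds (posLog s t)) := by
  rcases hs.eq_or_lt with rfl | hs
  · simp [posLog]
  rcases le_or_gt t 0 with ht | ht
  · rw [posLog, if_pos ⟨ht, hs⟩]
    refine ENNReal.tendsto_ofReal_atTop.comp ?_
    refine Filter.Tendsto.const_mul_atTop hs ?_
    have h : Filter.Tendsto (fun k : ℕ => Real.log s + (k : ℝ)) Filter.atTop Filter.atTop :=
      Filter.tendsto_atTop_add_const_left _ _ tendsto_natCast_atTop_atTop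
    refine h.congr' ?_
    filter_upwards [eventually_clampLog_eq hs] with k hk
    rw [hk, clampLog_of_nonpos ht, sub_neg_eq_add]
  · rw [posLog, if_neg fun h => h.1.not_gt ht]
    refine tendsto_const_nhds.congr' ?_
    filter_upwards [eventually_clampLog_eq hs, eventually_clampLog_eq ht] with k hk hk'
    rw [hk, hk']

theorem tendsto_negLog {s t : ℝ} (hs : 0 ≤ s) :
    Filter.Tendsto (fun k : ℕ => ENNReal.ofReal (s * (clampLog k t - clampLog k s)))
      Filter.atTop (nhds (negLog s t)) := by
  rcases hs.eq_or_lt with rfl | hs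
  · simp [negLog]
  rcases le_or_gt t 0 with ht | ht
  · rw [negLog, if_pos ⟨ht, hs⟩]
    refine tendsto_const_nhds.congr fun k => ?_
    rw [clampLog_of_nonpos ht, eq_comm, ENNReal.ofReal_eq_zero]
    exact mul_nonpos_of_nonneg_of_nonpos hs.le (by linarith [neg_le_clampLog k s])
  · rw [negLog, if_neg fun h => h.1.not_gt ht]
    refine tendsto_const_nhds.congr' ?_
    filter_upwards [eventually_clampLog_eq hs, eventually_clampLog_eq ht] with k hk hk'
    rw [hk, hk']

/-! ### Double spectral sums and the Pythagorean identity. -/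

/-- The sum `∑ s t, tr (E_s F_t) * f s t`. -/
def overlapSum (ψ φ : H →L[ℂ] H) (f : ℝ → ℝ → ℝ≥0∞) : ℝ≥0∞ :=
  ∑' (s : ℝ) (t : ℝ), overlap ψ φ s t * f s t

theorem overlapSum_add (ψ φ : H →L[ℂ] H) (f g : ℝ → ℝ → ℝ≥0∞) :
    overlapSum ψ φ f + overlapSum ψ φ g = overlapSum ψ φ fun s t => f s t + g s t := by
  simp only [overlapSum, ← ENNReal.tsum_add, mul_add]

theorem overlap_mul_le {ψ φ : H →L[ℂ] H} (hψ : ψ.IsPositive) (hφ : φ.IsPositive)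
    {f g : ℝ → ℝ → ℝ≥0∞} (h : ∀ s t, 0 ≤ s → 0 ≤ t → f s t ≤ g s t) (s t : ℝ) :
    overlap ψ φ s t * f s t ≤ overlap ψ φ s t * g s t := by
  rcases lt_or_ge s 0 with hs | hs
  · simp [overlap_of_neg_left hψ φ hs]
  rcases lt_or_ge t 0 with ht | ht
  · simp [overlap_of_neg_right ψ hφ s ht]
  · exact mul_le_mul_right (h s t hs ht) _

theorem overlapSum_mono {ψ φ : H →L[ℂ] H} (hψ : ψ.IsPositive) (hφ : φ.IsPositive)
    {f g : ℝ → ℝ → ℝ≥0∞} (h : ∀ s t, 0 ≤ s → 0 ≤ t → f s t ≤ g s t) :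
    overlapSum ψ φ f ≤ overlapSum ψ φ g :=
  ENNReal.tsum_le_tsum fun s => ENNReal.tsum_le_tsum fun t => overlap_mul_le hψ hφ h s t

theorem overlapSum_congr {ψ φ : H →L[ℂ] H} (hψ : ψ.IsPositive) (hφ : φ.IsPositive)
    {f g : ℝ → ℝ → ℝ≥0∞} (h : ∀ s t, 0 ≤ s → 0 ≤ t → f s t = g s t) :
    overlapSum ψ φ f = overlapSum ψ φ g :=
  le_antisymm (overlapSum_mono hψ hφ fun s t hs ht => (h s t hs ht).le)
    (overlapSum_mono hψ hφ fun s t hs ht => (h s t hs ht).ge)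

theorem tendsto_overlapSum {ψ φ : H →L[ℂ] H} (hψ : ψ.IsPositive)
    {f : ℕ → ℝ → ℝ → ℝ≥0∞} {g : ℝ → ℝ → ℝ≥0∞}
    (hf : ∀ s t, 0 ≤ s → Monotone fun k => f k s t)
    (hg : ∀ s t, 0 ≤ s → Filter.Tendsto (fun k => f k s t) Filter.atTop (nhds (g s t))) :
    Filter.Tendsto (fun k => overlapSum ψ φ (f k)) Filter.atTop
      (nhds (overlapSum ψ φ g)) := by
  have hm : ∀ s t, Monotone fun k => overlap ψ φ s t * f k s t := by
    intro s t k l hkl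
    rcases lt_or_ge s 0 with hs | hs
    · simp [overlap_of_neg_left hψ φ hs]
    · exact mul_le_mul_right (hf s t hs hkl) _
  refine tendsto_tsum_of_monotone
    (fun s k l hkl => ENNReal.tsum_le_tsum fun t => hm s t hkl) fun s => ?_
  refine tendsto_tsum_of_monotone (hm s) fun t => ?_
  rcases lt_or_ge s 0 with hs | hs
  · simp [overlap_of_neg_left hψ φ hs]
  · rw [tendsto_nhds_unique (hg s t hs) (tendsto_atTop_iSup (hf s t hs)), ENNReal.mul_iSup]
    exact tendsto_atTop_iSup (hm s t)

theorem overlapSum_left_self (ψ : H →L[ℂ] H) {φ : H →L[ℂ] H} (hφ : φ ∈ states H)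
    (f : ℝ → ℝ≥0∞) :
    overlapSum ψ φ (fun s _ => ENNReal.ofReal s * f s) =
      ∑' s, conjTrace ψ (eigenProj ψ s) * f s := by
  refine tsum_congr fun s => ?_
  rw [ENNReal.tsum_mul_right, tsum_overlap_right _ hφ, conjTrace_eigenProj]
  ring

theorem overlapSum_right {ψ : H →L[ℂ] H} (hψ : ψ ∈ states H) (φ : H →L[ℂ] H) (f : ℝ → ℝ≥0∞) :
    overlapSum ψ φ (fun s t => ENNReal.ofReal s * f t) =
      ∑' t, conjTrace ψ (eigenProj φ t) * f t := by
  rw [overlapSum, ENNReal.tsum_comm]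
  refine tsum_congr fun t => ?_
  simp only [← mul_assoc]
  rw [ENNReal.tsum_mul_right, tsum_mul_overlap_left hψ]

/-- `(a - b)⁺ - (b - a)⁺ = (c - b) - (c - a)`, rearranged so that every term is nonnegative. -/
theorem ofReal_add_ofReal_neg {s a b c : ℝ} (hs : 0 ≤ s) (ha : a ≤ c) (hb : b ≤ c) :
    ENNReal.ofReal (s * (a - b)) + ENNReal.ofReal s * ENNReal.ofReal (c - a) =
      ENNReal.ofReal (s * (b - a)) + ENNReal.ofReal s * ENNReal.ofReal (c - b) := by
  rw [← ENNReal.ofReal_mul hs, ← ENNReal.ofReal_mul hs]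
  have h1 : 0 ≤ s * (c - a) := mul_nonneg hs (by linarith)
  have h2 : 0 ≤ s * (c - b) := mul_nonneg hs (by linarith)
  rcases le_total a b with h | h
  · rw [ENNReal.ofReal_of_nonpos (mul_nonpos_of_nonneg_of_nonpos hs (sub_nonpos.2 h)), zero_add,
      ← ENNReal.ofReal_add (mul_nonneg hs (sub_nonneg.2 h)) h2]
    ring_nf
  · rw [ENNReal.ofReal_of_nonpos (p := s * (b - a))
      (mul_nonpos_of_nonneg_of_nonpos hs (sub_nonpos.2 h)), zero_add,
      ← ENNReal.ofReal_add (mul_nonneg hs (sub_nonneg.2 h)) h1]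
    ring_nf

/-- The truncated cross entropy `-tr (ψ log φ)`, shifted by the truncation level `k`. -/
def crossEntropy (k : ℕ) (ψ φ : H →L[ℂ] H) : ℝ≥0∞ :=
  ∑' t, conjTrace ψ (eigenProj φ t) * ENNReal.ofReal (k - clampLog k t)

/-- The truncated form of `D(ψ‖φ) = -tr (ψ log φ) + tr (ψ log ψ)`; the shifts by `k` occur on both
sides. -/
theorem overlapSum_clampLog_add {ψ φ : H →L[ℂ] H} (hψ : ψ ∈ states H) (hφ : φ ∈ states H)
    (k : ℕ) :
    overlapSum ψ φ (fun s t => ENNReal.ofReal (s * (clampLog k s - clampLog k t))) +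
        crossEntropy k ψ ψ =
      overlapSum ψ φ (fun s t => ENNReal.ofReal (s * (clampLog k t - clampLog k s))) +
        crossEntropy k ψ φ := by
  rw [crossEntropy, ← overlapSum_left_self ψ hφ, crossEntropy, ← overlapSum_right hψ φ,
    overlapSum_add, overlapSum_add]
  exact overlapSum_congr hψ.1 hφ.1 fun s t hs _ =>
    ofReal_add_ofReal_neg hs (clampLog_le k s) (clampLog_le k t)

/-- The integrand lies in `[0, 2k]` and the weights sum to `tr ψ = 1`; finiteness allows
cancellation. -/
theorem crossEntropy_ne_top {ψ φ : H →L[ℂ] H} (hψ : ψ ∈ states H) (hφ : φ ∈ states H) (k : ℕ) :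
    crossEntropy k ψ φ ≠ ⊤ := by
  refine ne_top_of_le_ne_top (b := ENNReal.ofReal (2 * k)) ENNReal.ofReal_ne_top ?_
  have h : ∑' t, conjTrace ψ (eigenProj φ t) = 1 := by
    have := overlapSum_right hψ φ 1
    simp only [Pi.one_apply, mul_one] at this
    rw [← this]
    exact tsum_tsum_overlap_mul_left hψ hφ
  calc crossEntropy k ψ φ
      ≤ ∑' t, conjTrace ψ (eigenProj φ t) * ENNReal.ofReal (2 * k) :=
        ENNReal.tsum_le_tsum fun t => mul_le_mul_right
          (ENNReal.ofReal_le_ofReal (by linarith [neg_le_clampLog k t])) _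
    _ = ENNReal.ofReal (2 * k) := by rw [ENNReal.tsum_mul_right, h, one_mul]

/-- The Pythagorean identity `D(ψ‖φ) = D(ψ‖ω) + D(ω‖φ)`, where `ω` and `ψ` have the same
diagonal in the eigenspaces of `φ` and of `ω`, written without subtraction. -/
theorem overlapSum_pythagorean {ψ φ ω : H →L[ℂ] H} (hψ : ψ ∈ states H) (hφ : φ ∈ states H)
    (hω : ω ∈ states H)
    (h1 : ∀ t, conjTrace ω (eigenProj φ t) = conjTrace ψ (eigenProj φ t))
    (h2 : ∀ t, conjTrace ω (eigenProj ω t) = conjTrace ψ (eigenProj ω t)) :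
    overlapSum ψ φ posLog + overlapSum ψ ω negLog + overlapSum ω φ negLog =
      overlapSum ψ φ negLog + overlapSum ψ ω posLog + overlapSum ω φ posLog := by
  have hpos : ∀ {α : H →L[ℂ] H} (β : H →L[ℂ] H), α ∈ states H → Filter.Tendsto
      (fun k : ℕ => overlapSum α β
        (fun s t => ENNReal.ofReal (s * (clampLog k s - clampLog k t))))
      Filter.atTop (nhds (overlapSum α β posLog)) := fun β hα =>
    tendsto_overlapSum hα.1 (fun s t hs => monotone_ofReal_clampLog hs s t)
      fun s t hs => tendsto_posLog hs
  have hneg : ∀ {α : H →L[ℂ] H} (β : H →L[ℂ] H), α ∈ states H → Filter.Tendsto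
      (fun k : ℕ => overlapSum α β
        (fun s t => ENNReal.ofReal (s * (clampLog k t - clampLog k s))))
      Filter.atTop (nhds (overlapSum α β negLog)) := fun β hα =>
    tendsto_overlapSum hα.1 (fun s t hs => monotone_ofReal_clampLog hs t s)
      fun s t hs => tendsto_negLog hs
  -- It suffices to prove the identity at each truncation level, where all cross entropies are
  -- finite and cancel.
  refine tendsto_nhds_unique (((hpos φ hψ).add (hneg ω hψ)).add (hneg φ hω))
    ((((hneg φ hψ).add (hpos ω hψ)).add (hpos φ hω)).congr fun k => ?_)
  have e1 := overlapSum_clampLog_add hψ hφ k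
  have e2 := overlapSum_clampLog_add hψ hω k
  have e3 := overlapSum_clampLog_add hω hφ k
  have c1 : crossEntropy k ω φ = crossEntropy k ψ φ :=
    tsum_congr fun t => by rw [h1]
  have c2 : crossEntropy k ω ω = crossEntropy k ψ ω :=
    tsum_congr fun t => by rw [h2]
  rw [c1, c2] at e3
  have f1 := crossEntropy_ne_top hψ hφ k
  have f2 := crossEntropy_ne_top hψ hψ k
  have f3 := crossEntropy_ne_top hψ hω k
  have hfin : crossEntropy k ψ φ + crossEntropy k ψ ψ + crossEntropy k ψ ω ≠ ⊤ := by
    simp [f1, f2, f3]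
  rw [← ENNReal.add_left_inj hfin]
  generalize overlapSum ψ φ _ = p1 at *
  generalize overlapSum ψ φ _ = n1 at *
  generalize overlapSum ψ ω _ = p2 at *
  generalize overlapSum ψ ω _ = n2 at *
  generalize overlapSum ω φ _ = p3 at *
  generalize overlapSum ω φ _ = n3 at *
  generalize crossEntropy k ψ φ = L at *
  generalize crossEntropy k ψ ψ = A at *
  generalize crossEntropy k ψ ω = B at *
  calc n1 + p2 + p3 + (L + A + B) = (n1 + L) + (p2 + A) + (p3 + B) := by ring
    _ = (p1 + A) + (n2 + B) + (n3 + L) := by rw [e1, e2, e3]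
    _ = p1 + n2 + n3 + (L + A + B) := by ring

/-! ### Klein's inequality and its equality case. -/

theorem mul_log_sub_log_lt {s t : ℝ} (hs : 0 < s) (ht : 0 < t) (h : s ≠ t) :
    s * (Real.log t - Real.log s) < t - s := by
  rw [← Real.log_div ht.ne' hs.ne']
  have h1 := Real.log_lt_sub_one_of_pos (div_pos ht hs)
    (fun e => h ((div_eq_one_iff_eq hs.ne').1 e).symm)
  calc s * Real.log (t / s) < s * (t / s - 1) := mul_lt_mul_of_pos_left h1 hs
    _ = t - s := by field_simp

theorem negLog_le {s t : ℝ} (hs : 0 ≤ s) (ht : 0 ≤ t) : negLog s t ≤ ENNReal.ofReal t := by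
  unfold negLog
  split_ifs with h
  · exact zero_le
  · refine ENNReal.ofReal_le_ofReal ?_
    rcases hs.eq_or_lt with rfl | hs
    · simpa using ht
    rcases ht.eq_or_lt with rfl | ht
    · exact absurd ⟨le_rfl, hs⟩ h
    rcases eq_or_ne s t with rfl | hst
    · simpa using ht.le
    · linarith [mul_log_sub_log_lt hs ht hst]

/-- This is `s (log s - log t) > s - t` without subtraction. The linear terms have the same total
over the overlaps, `tr ψ = tr φ = 1`, and drop out. -/
theorem negLog_add_lt {s t : ℝ} (hs : 0 ≤ s) (ht : 0 ≤ t) (hst : s ≠ t) :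
    negLog s t + ENNReal.ofReal s < posLog s t + ENNReal.ofReal t := by
  unfold negLog posLog
  rcases hs.eq_or_lt with rfl | hs
  · simpa using lt_of_le_of_ne ht hst
  rcases ht.eq_or_lt with rfl | ht
  · simp [hs]
  have hc : ¬ (t ≤ 0 ∧ 0 < s) := fun h => h.1.not_gt ht
  rw [if_neg hc, if_neg hc]
  have h1 := mul_log_sub_log_lt hs ht hst
  have h2 : s * (Real.log s - Real.log t) = -(s * (Real.log t - Real.log s)) := by ring
  rw [h2]
  rcases le_total 0 (s * (Real.log t - Real.log s)) with h | h
  · rw [ENNReal.ofReal_of_nonpos (neg_nonpos.2 h), zero_add, ← ENNReal.ofReal_add h hs.le]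
    exact (ENNReal.ofReal_lt_ofReal_iff ht).2 (by linarith)
  · rw [ENNReal.ofReal_of_nonpos h, zero_add, ← ENNReal.ofReal_add (neg_nonneg.2 h) ht.le]
    exact (ENNReal.ofReal_lt_ofReal_iff (by linarith)).2 (by linarith)

theorem negLog_add_le {s t : ℝ} (hs : 0 ≤ s) (ht : 0 ≤ t) :
    negLog s t + ENNReal.ofReal s ≤ posLog s t + ENNReal.ofReal t := by
  rcases eq_or_ne s t with rfl | h
  · refine add_le_add ?_ le_rfl
    unfold negLog posLog
    split_ifs <;> simp
  · exact (negLog_add_lt hs ht h).le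

section States

variable {ψ φ : H →L[ℂ] H}

theorem overlapSum_negLog_le_one (hψ : ψ ∈ states H) (hφ : φ ∈ states H) :
    overlapSum ψ φ negLog ≤ 1 := by
  rw [← tsum_tsum_overlap_mul_right hψ hφ]
  exact overlapSum_mono hψ.1 hφ.1 fun s t hs ht => negLog_le hs ht

theorem overlapSum_negLog_le_posLog (hψ : ψ ∈ states H) (hφ : φ ∈ states H) :
    overlapSum ψ φ negLog ≤ overlapSum ψ φ posLog := by
  have h := overlapSum_mono hψ.1 hφ.1 fun s t hs ht => negLog_add_le (s := s) (t := t) hs ht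
  rw [← overlapSum_add, ← overlapSum_add,
    show overlapSum ψ φ (fun s _ => ENNReal.ofReal s) = 1 from tsum_tsum_overlap_mul_left hψ hφ,
    show overlapSum ψ φ (fun _ t => ENNReal.ofReal t) = 1 from tsum_tsum_overlap_mul_right hψ hφ]
    at h
  exact (ENNReal.add_le_add_iff_right ENNReal.one_ne_top).1 h

/-- `F_t E_s = 0` for all `t ≠ s` forces `F_s E_s = E_s`, so `φ` acts as `s` on the range of `E_s`,
as `ψ` does. -/
theorem eq_of_overlap_eq_zero (hψ : ψ ∈ states H) (hφ : φ ∈ states H)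
    (h : ∀ s t, s ≠ t → overlap ψ φ s t = 0) : ψ = φ := by
  have h0 : ∀ s t x, s ≠ t → eigenProj φ t (eigenProj ψ s x) = 0 := by
    intro s t x hst
    have := h s t hst
    rw [overlap_eq_hsSq, hsSq_eq_zero] at this
    exact congrArg (fun T : H →L[ℂ] H => T x) this
  have h1 : ∀ s x, eigenProj φ s (eigenProj ψ s x) = eigenProj ψ s x := fun s x =>
    (hasSum_single s fun t ht => h0 s t x ht.symm).unique (hasSum_eigenProj hφ _)
  ext x
  have e1 := (hasSum_eigenProj hψ x).mapL ψ
  have e2 := (hasSum_eigenProj hψ x).mapL φ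
  refine e1.unique ?_
  convert e2 using 2 with s
  rw [apply_eigenProj, ← h1, apply_eigenProj]

/-- The equality case of Klein's inequality. -/
theorem eq_of_overlapSum_eq (hψ : ψ ∈ states H) (hφ : φ ∈ states H)
    (h : overlapSum ψ φ posLog ≤ overlapSum ψ φ negLog) : ψ = φ := by
  -- A nonzero overlap at some `s ≠ t` would make one term of Klein's inequality strict, and hence
  -- the finite sums too.
  refine eq_of_overlap_eq_zero hψ hφ fun s t hst => ?_
  by_contra hne
  have hs : 0 ≤ s := by
    by_contra hs
    exact hne (overlap_of_neg_left hψ.1 φ (not_le.1 hs) t)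
  have ht : 0 ≤ t := by
    by_contra ht
    exact hne (overlap_of_neg_right ψ hφ.1 s (not_le.1 ht))
  have e1 : overlapSum ψ φ (fun s t => negLog s t + ENNReal.ofReal s) =
      overlapSum ψ φ negLog + 1 := by
    rw [← overlapSum_add]
    congr 1
    exact tsum_tsum_overlap_mul_left hψ hφ
  have e2 : overlapSum ψ φ (fun s t => posLog s t + ENNReal.ofReal t) =
      overlapSum ψ φ posLog + 1 := by
    rw [← overlapSum_add]
    congr 1
    exact tsum_tsum_overlap_mul_right hψ hφ
  have hfin : overlapSum ψ φ (fun s t => negLog s t + ENNReal.ofReal s) ≠ ⊤ := by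
    rw [e1]
    exact ENNReal.add_ne_top.2
      ⟨ne_top_of_le_ne_top ENNReal.one_ne_top (overlapSum_negLog_le_one hψ hφ),
        ENNReal.one_ne_top⟩
  have hle := overlap_mul_le hψ.1 hφ.1 fun s t hs ht => negLog_add_le (s := s) (t := t) hs ht
  have hfin' : ∑' t, overlap ψ φ s t * (negLog s t + ENNReal.ofReal s) ≠ ⊤ :=
    ENNReal.ne_top_of_tsum_ne_top hfin s
  have hlt : overlap ψ φ s t * (negLog s t + ENNReal.ofReal s) <
      overlap ψ φ s t * (posLog s t + ENNReal.ofReal t) := by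
    -- Overlaps can be infinite only at `s = t = 0`: the sums weighted by `s` and by `t` both equal
    -- `1`, and here `s` or `t` is positive.
    have htop : overlap ψ φ s t ≠ ⊤ := by
      intro htop
      have h1 := ENNReal.ne_top_of_tsum_ne_top (ENNReal.ne_top_of_tsum_ne_top
        (ne_of_eq_of_ne (tsum_tsum_overlap_mul_left hψ hφ) ENNReal.one_ne_top) s) t
      have h2 := ENNReal.ne_top_of_tsum_ne_top (ENNReal.ne_top_of_tsum_ne_top
        (ne_of_eq_of_ne (tsum_tsum_overlap_mul_right hψ hφ) ENNReal.one_ne_top) s) t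
      rw [htop] at h1 h2
      rcases hs.eq_or_lt with rfl | hs
      · exact h2 (ENNReal.top_mul (by simpa using lt_of_le_of_ne ht hst))
      · exact h1 (ENNReal.top_mul (by simpa using hs))
    exact (ENNReal.mul_lt_mul_iff_right hne htop).2 (negLog_add_lt hs ht hst)
  have := ENNReal.tsum_lt_tsum hfin (fun s => ENNReal.tsum_le_tsum (hle s))
    (ENNReal.tsum_lt_tsum hfin' (hle s) hlt)
  change overlapSum ψ φ (fun s t => negLog s t + ENNReal.ofReal s) <
    overlapSum ψ φ (fun s t => posLog s t + ENNReal.ofReal t) at this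
  rw [e1, e2] at this
  exact (lt_of_add_lt_add_right this).not_ge h

/-! ### Finiteness of the distance under domination `ψ ≤ c φ`. -/

theorem mul_norm_sq_eigenProj_le (hψ : ψ ∈ states H) {s : ℝ} (hs : 0 ≤ s) (y : H) :
    s * ‖eigenProj ψ s y‖ ^ 2 ≤ (⟪y, ψ y⟫_ℂ).re := by
  have h : ENNReal.ofReal s * ENNReal.ofReal (‖eigenProj ψ s y‖ ^ 2) ≤
      ENNReal.ofReal (⟪y, ψ y⟫_ℂ).re :=
    tsum_mul_norm_sq_eigenProj hψ y ▸ ENNReal.le_tsum s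
  rw [← ENNReal.ofReal_mul hs, ENNReal.ofReal_le_ofReal_iff] at h
  · exact h
  · exact hψ.1.re_inner_nonneg_right y

theorem overlap_zero_eq_zero_of_le {c : ℝ} (hψ : ψ ∈ states H)
    (hle : ∀ y, (⟪y, ψ y⟫_ℂ).re ≤ c * (⟪y, φ y⟫_ℂ).re) {s : ℝ} (hs : 0 < s) :
    overlap ψ φ s 0 = 0 := by
  rw [overlap_comm, overlap_eq_hsSq, hsSq_eq_zero]
  ext x
  have h := (mul_norm_sq_eigenProj_le hψ hs.le (eigenProj φ 0 x)).trans (hle _)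
  rw [apply_eigenProj] at h
  simp only [Complex.ofReal_zero, zero_smul, inner_zero_right, Complex.zero_re, mul_zero] at h
  have h2 : ‖eigenProj ψ s (eigenProj φ 0 x)‖ ^ 2 ≤ 0 := by
    by_contra hc
    exact (mul_pos hs (not_le.1 hc)).not_ge h
  simpa using le_antisymm h2 (by positivity)

/-- If `ψ ≤ c φ`, then `⟨x, φ⁻¹ x⟩ ≤ c / s` for unit vectors `x` in the eigenspace of `ψ` at
`s`. -/
theorem sum_norm_sq_eigenProj_div_le {c : ℝ} (hc : 0 ≤ c) (hψ : ψ ∈ states H) (hφ : φ ∈ states H)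
    (hle : ∀ y, (⟪y, ψ y⟫_ℂ).re ≤ c * (⟪y, φ y⟫_ℂ).re) {s : ℝ}
    (hs : 0 < s) (x : H)
    (F : Finset ℝ) (hF : ∀ t ∈ F, 0 < t) :
    s * ∑ t ∈ F, ‖eigenProj φ t (eigenProj ψ s x)‖ ^ 2 / t ≤ c * ‖eigenProj ψ s x‖ ^ 2 := by
  set z := eigenProj ψ s x with hz
  have hzz : eigenProj ψ s z = z := eigenProj_idem ψ s x
  set M : ℝ := ∑ t ∈ F, ‖eigenProj φ t z‖ ^ 2 / t with hM
  -- `y` is `φ⁻¹ z` cut off to the eigenvalues in `F`, so that `⟨z, y⟩ = ⟨y, φ y⟩ = M`. Then `M ≤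
  -- ‖z‖ ‖E_s y‖` and `s ‖E_s y‖² ≤ ⟨y, ψ y⟩ ≤ c M` give `s M² ≤ c M ‖z‖²`.
  set y : H := ∑ t ∈ F, ((t⁻¹ : ℝ) : ℂ) • eigenProj φ t z with hy
  have h1 : ⟪z, y⟫_ℂ = ((M : ℝ) : ℂ) := by
    rw [hy, inner_sum, hM, Complex.ofReal_sum]
    refine Finset.sum_congr rfl fun t _ => ?_
    rw [inner_smul_right, inner_eigenProj_self]
    push_cast
    ring
  have h2 : φ y = ∑ t ∈ F, eigenProj φ t z := by
    rw [hy, map_sum]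
    refine Finset.sum_congr rfl fun t ht => ?_
    rw [map_smul, apply_eigenProj, smul_smul, ← Complex.ofReal_mul,
      inv_mul_cancel₀ (hF t ht).ne', Complex.ofReal_one, one_smul]
  have h3 : (⟪y, φ y⟫_ℂ).re = M := by
    have h4 : ∀ t ∈ F, eigenProj φ t y = ((t⁻¹ : ℝ) : ℂ) • eigenProj φ t z := by
      intro t ht
      rw [hy, map_sum, Finset.sum_eq_single_of_mem t ht]
      · rw [map_smul, eigenProj_idem]
      · intro r _ hr
        rw [map_smul, eigenProj_apply_eigenProj hφ.1 hr.symm, smul_zero]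
    rw [h2, inner_sum, Complex.re_sum, hM]
    refine Finset.sum_congr rfl fun t ht => ?_
    rw [← inner_eigenProj_left, h4 t ht, inner_smul_left, inner_eigenProj_left,
      inner_eigenProj_self, Complex.conj_ofReal, ← Complex.ofReal_mul,
      Complex.ofReal_re]
    ring
  have hM0 : 0 ≤ M := Finset.sum_nonneg fun t ht => div_nonneg (by positivity) (hF t ht).le
  have h5 : M ≤ ‖z‖ * ‖eigenProj ψ s y‖ := by
    calc M = ‖⟪z, y⟫_ℂ‖ := by rw [h1, Complex.norm_real, Real.norm_of_nonneg hM0]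
      _ = ‖⟪z, eigenProj ψ s y⟫_ℂ‖ := by rw [← inner_eigenProj_left, hzz]
      _ ≤ _ := norm_inner_le_norm _ _
  have h6 := (mul_norm_sq_eigenProj_le hψ hs.le y).trans (hle y)
  rw [h3] at h6
  rcases hM0.eq_or_lt with h0 | hMpos
  · rw [← h0, mul_zero]
    positivity
  · have h7 : M ^ 2 ≤ ‖z‖ ^ 2 * ‖eigenProj ψ s y‖ ^ 2 := by
      rw [← mul_pow]
      exact pow_le_pow_left₀ hM0 h5 2
    have h8 : M * (s * M) ≤ M * (c * ‖z‖ ^ 2) := by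
      calc M * (s * M) = s * M ^ 2 := by ring
        _ ≤ s * (‖z‖ ^ 2 * ‖eigenProj ψ s y‖ ^ 2) := mul_le_mul_of_nonneg_left h7 hs.le
        _ = ‖z‖ ^ 2 * (s * ‖eigenProj ψ s y‖ ^ 2) := by ring
        _ ≤ ‖z‖ ^ 2 * (c * M) := mul_le_mul_of_nonneg_left h6 (by positivity)
        _ = M * (c * ‖z‖ ^ 2) := by ring
    exact le_of_mul_le_mul_left h8 hMpos

/-- `log (s / t) ≤ s / t` bounds the sum by `s² tr (E_s φ⁻¹ E_s)`, which is at most `c s tr E_s`.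
Summing over `s` then gives `c tr ψ = c`. -/
theorem tsum_overlap_mul_posLog_le {c : ℝ} (hc : 0 ≤ c) (hψ : ψ ∈ states H) (hφ : φ ∈ states H)
    (hle : ∀ y, (⟪y, ψ y⟫_ℂ).re ≤ c * (⟪y, φ y⟫_ℂ).re) (s : ℝ) :
    ∑' t, overlap ψ φ s t * posLog s t ≤
      ENNReal.ofReal c * (ENNReal.ofReal s * hsSq (eigenProj ψ s)) := by
  rcases lt_or_ge s 0 with hs | hs
  · simp [overlap_of_neg_left hψ.1 φ hs]
  rcases hs.eq_or_lt with rfl | hs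
  · simp [posLog]
  have hterm : ∀ t, overlap ψ φ s t * posLog s t ≤ ∑' i, if 0 < t then
      ENNReal.ofReal (s ^ 2 * (‖eigenProj φ t (eigenProj ψ s (basis H i))‖ ^ 2 / t)) else 0 := by
    intro t
    rcases lt_trichotomy t 0 with ht | rfl | ht
    · simp [overlap_of_neg_right ψ hφ.1 s ht]
    · simp [overlap_zero_eq_zero_of_le hψ hle hs]
    · simp only [if_pos ht]
      rw [overlap_eq_hsSq, hsSq, ← ENNReal.tsum_mul_right]
      refine ENNReal.tsum_le_tsum fun i => ?_
      rw [posLog, if_neg fun h => h.1.not_gt ht, ← ENNReal.ofReal_mul (by positivity)]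
      refine ENNReal.ofReal_le_ofReal ?_
      rw [← Real.log_div hs.ne' ht.ne']
      have h1 : Real.log (s / t) ≤ s / t := (Real.log_le_sub_one_of_pos (div_pos hs ht)).trans
        (by linarith)
      calc _ ≤ ‖(eigenProj φ t * eigenProj ψ s) (basis H i)‖ ^ 2 * (s * (s / t)) := by gcongr
        _ = _ := by rw [mul_apply_eq_comp]; ring
  refine (ENNReal.tsum_le_tsum hterm).trans ?_
  rw [ENNReal.tsum_comm, hsSq, ← ENNReal.tsum_mul_left, ← ENNReal.tsum_mul_left]
  refine ENNReal.tsum_le_tsum fun i => ?_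
  rw [ENNReal.tsum_eq_iSup_sum]
  refine iSup_le fun F => ?_
  rw [← Finset.sum_filter, ← ENNReal.ofReal_sum_of_nonneg, ← ENNReal.ofReal_mul hs.le,
    ← ENNReal.ofReal_mul hc, ← Finset.mul_sum]
  · refine ENNReal.ofReal_le_ofReal ?_
    have := sum_norm_sq_eigenProj_div_le hc hψ hφ hle hs (basis H i) (F.filter fun t => 0 < t)
      fun t ht => (Finset.mem_filter.1 ht).2
    have := mul_le_mul_of_nonneg_left this hs.le
    linarith
  · intro t ht
    have := (Finset.mem_filter.1 ht).2
    positivity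

theorem overlapSum_posLog_ne_top {c : ℝ} (hc : 0 ≤ c) (hψ : ψ ∈ states H) (hφ : φ ∈ states H)
    (hle : ∀ y, (⟪y, ψ y⟫_ℂ).re ≤ c * (⟪y, φ y⟫_ℂ).re) :
    overlapSum ψ φ posLog ≠ ⊤ := by
  refine ne_top_of_le_ne_top (ENNReal.ofReal_ne_top (r := c))
    ((ENNReal.tsum_le_tsum (tsum_overlap_mul_posLog_le hc hψ hφ hle)).trans_eq ?_)
  rw [ENNReal.tsum_mul_left, tsum_mul_hsSq hψ, mul_one]

/-! ### Supports and the distance as a difference of double sums. -/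

theorem support_eq_orthogonal (hφ : φ.IsPositive) :
    support φ = (Module.End.eigenspace (φ : H →ₗ[ℂ] H) ((0 : ℝ) : ℂ))ᗮ := by
  have h1 : Module.End.eigenspace (φ : H →ₗ[ℂ] H) ((0 : ℝ) : ℂ) =
      (LinearMap.range (φ : H →ₗ[ℂ] H))ᗮ := by
    ext x
    rw [Module.End.mem_eigenspace_iff, Submodule.mem_orthogonal]
    simp only [Complex.ofReal_zero, zero_smul, LinearMap.mem_range, forall_exists_index,
      forall_apply_eq_imp_iff]
    constructor
    · intro h y
      exact (hφ.inner_left_eq_inner_right y x).trans (by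
        rw [show φ x = 0 from h, inner_zero_right])
    · intro h
      refine ext_inner_left ℂ fun y => ?_
      rw [inner_zero_right]
      exact (hφ.inner_left_eq_inner_right y x).symm.trans (h y)
  rw [h1, Submodule.orthogonal_orthogonal_eq_closure]
  rfl

theorem support_le_iff (hψ : ψ ∈ states H) (hφ : φ ∈ states H) :
    support ψ ≤ support φ ↔ ∀ s, 0 < s → overlap ψ φ s 0 = 0 := by
  have hz : ∀ x, eigenProj φ 0 x = 0 ↔ x ∈ support φ := fun x => by
    rw [support_eq_orthogonal hφ.1]
    exact Submodule.starProjection_apply_eq_zero_iff _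
  constructor
  · intro h s hs
    rw [overlap_eq_hsSq, hsSq_eq_zero]
    ext x
    refine (hz _).2 (h (Submodule.le_topologicalClosure _ ⟨((s⁻¹ : ℝ) : ℂ) • eigenProj ψ s x, ?_⟩))
    change ψ _ = _
    rw [map_smul, apply_eigenProj, smul_smul, ← Complex.ofReal_mul, inv_mul_cancel₀ hs.ne',
      Complex.ofReal_one, one_smul]
    rfl
  · intro h
    refine Submodule.topologicalClosure_minimal _ ?_ (Submodule.isClosed_topologicalClosure _)
    rintro _ ⟨x, rfl⟩
    refine (hz _).1 ?_
    have h1 := ((hasSum_eigenProj hψ x).mapL ψ).mapL (eigenProj φ 0)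
    refine h1.unique ?_
    convert hasSum_zero with s
    rw [apply_eigenProj, map_smul]
    rcases lt_trichotomy s 0 with hs | rfl | hs
    · simp [eigenProj_of_neg hψ.1 hs]
    · simp
    · have := h s hs
      rw [overlap_eq_hsSq, hsSq_eq_zero] at this
      have e : eigenProj φ 0 (eigenProj ψ s x) = 0 :=
        congrArg (fun T : H →L[ℂ] H => T x) this
      rw [e, smul_zero]

/-- The value `∞` of `posLog` at `t = 0 < s` absorbs the support condition: it carries positive
weight exactly when the inclusion fails. When the inclusion holds, the default `Real.log 0 = 0` has
weight zero there. -/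
theorem umegaki_eq (hψ : ψ ∈ states H) (hφ : φ ∈ states H) :
    umegaki φ ψ = (overlapSum ψ φ posLog : EReal) - (overlapSum ψ φ negLog : EReal) := by
  unfold umegaki
  split_ifs with h
  · rw [support_le_iff hψ hφ] at h
    unfold traceLog
    congr 2
    · refine tsum_congr fun s => tsum_congr fun t => ?_
      unfold posLog
      split_ifs with hst
      · have h0 : overlap ψ φ s t = 0 := by
          rcases hst.1.lt_or_eq with ht | rfl
          · exact overlap_of_neg_right ψ hφ.1 s ht
          · exact h s hst.2
        simp [h0]
      · rfl
    · refine tsum_congr fun s => tsum_congr fun t => ?_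
      unfold negLog
      split_ifs with hst
      · have h0 : overlap ψ φ s t = 0 := by
          rcases hst.1.lt_or_eq with ht | rfl
          · exact overlap_of_neg_right ψ hφ.1 s ht
          · exact h s hst.2
        simp [h0]
      · rw [← mul_neg, neg_sub]
  · rw [support_le_iff hψ hφ] at h
    push Not at h
    obtain ⟨s, hs, hne⟩ := h
    have htop : overlapSum ψ φ posLog = ⊤ := by
      refine ENNReal.tsum_eq_top_of_eq_top ⟨s, ENNReal.tsum_eq_top_of_eq_top ⟨0, ?_⟩⟩
      rw [posLog, if_pos ⟨le_rfl, hs⟩]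
      exact ENNReal.mul_top hne
    rw [htop]
    have hn := ne_top_of_le_ne_top ENNReal.one_ne_top (overlapSum_negLog_le_one hψ hφ)
    rw [EReal.coe_ennreal_top, EReal.top_sub]
    exact EReal.coe_ennreal_eq_top_iff.not.2 hn

end States

end QEntropy

end

/-! ### Minimality and uniqueness. -/

theorem mainTheorem2 {H : Type*} [NormedAddCommGroup H] [InnerProductSpace ℂ H] [CompleteSpace H]
    {n : ℕ} (P : Fin n → (H →L[ℂ] H))
    (hP : ∀ i, IsStarProjection (P i))
    (hPP : ∀ i j, P i * P j = if i = j then P i else 0)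
    (hsum : ∑ i, P i = 1)
    (ψ : H →L[ℂ] H) (hψ : ψ ∈ QEntropy.states H) :
    QEntropy.argInf QEntropy.umegaki (QEntropy.commutingStates P) ψ
      = {∑ i, P i * ψ * P i} := by
  open QEntropy in
  set ω := luders P ψ with hω
  have hωQ : ω ∈ commutingStates P := luders_mem_commutingStates hP hPP hsum hψ
  have key : ∀ φ ∈ commutingStates P, umegaki ω ψ ≤ umegaki φ ψ ∧
      (umegaki φ ψ ≤ umegaki ω ψ → φ = ω) := by
    intro φ hφ
    have hpyth := overlapSum_pythagorean hψ hφ.1 hωQ.1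
      (conjTrace_eigenProj_luders hP hsum hψ.1 hφ) (conjTrace_eigenProj_luders hP hsum hψ.1 hωQ)
    have hn1 := ne_top_of_le_ne_top ENNReal.one_ne_top (overlapSum_negLog_le_one hψ hφ.1)
    have hn2 := ne_top_of_le_ne_top ENNReal.one_ne_top (overlapSum_negLog_le_one hψ hωQ.1)
    have hn3 := ne_top_of_le_ne_top ENNReal.one_ne_top (overlapSum_negLog_le_one hωQ.1 hφ.1)
    have hp2 : overlapSum ψ ω posLog ≠ ⊤ := overlapSum_posLog_ne_top n.cast_nonneg hψ hωQ.1
      (inner_le_card_mul_inner_luders hP hsum hψ.1)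
    have hle := overlapSum_negLog_le_posLog hωQ.1 hφ.1
    have heq := eq_of_overlapSum_eq hωQ.1 hφ.1
    rw [umegaki_eq hψ hφ.1, umegaki_eq hψ hωQ.1]
    generalize overlapSum ψ φ posLog = p1 at *
    generalize overlapSum ψ φ negLog = n1 at *
    generalize overlapSum ψ ω posLog = p2 at *
    generalize overlapSum ψ ω negLog = n2 at *
    generalize overlapSum ω φ posLog = p3 at *
    generalize overlapSum ω φ negLog = n3 at *
    lift n1 to NNReal using hn1
    lift n2 to NNReal using hn2
    lift n3 to NNReal using hn3
    lift p2 to NNReal using hp2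
    have hR : ∀ x : NNReal, (((x : ℝ≥0∞) : EReal)) = ((x : ℝ) : EReal) := fun x => rfl
    -- An infinite positive part means distance `⊤`, which cannot match the finite value at `ω`.
    -- Otherwise the Pythagorean identity makes all six sums finite and can be read in `ℝ`.
    rcases eq_or_ne p1 ⊤ with rfl | hp1
    · rw [EReal.coe_ennreal_top, hR, hR, hR, EReal.top_sub (EReal.coe_ne_top _), ← EReal.coe_sub]
      exact ⟨le_top, fun h => absurd (top_le_iff.1 h) (EReal.coe_ne_top _)⟩
    · have hp3 : p3 ≠ ⊤ := by
        rintro rfl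
        rw [add_top] at hpyth
        exact ENNReal.add_ne_top.2
          ⟨ENNReal.add_ne_top.2 ⟨hp1, ENNReal.coe_ne_top⟩, ENNReal.coe_ne_top⟩ hpyth
      lift p1 to NNReal using hp1
      lift p3 to NNReal using hp3
      rw [hR, hR, hR, hR, ← EReal.coe_sub, ← EReal.coe_sub, EReal.coe_le_coe_iff,
        EReal.coe_le_coe_iff]
      have hpyth' : (p1 : ℝ) + n2 + n3 = n1 + p2 + p3 := by exact_mod_cast hpyth
      have hle' : (n3 : ℝ) ≤ p3 := by exact_mod_cast hle
      refine ⟨by linarith, fun h => (heq ?_).symm⟩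
      have : (p3 : ℝ) ≤ n3 := by linarith
      exact_mod_cast this
  refine Set.eq_singleton_iff_unique_mem.2 ⟨⟨hωQ, fun φ hφ => (key φ hφ).1⟩, ?_⟩
  intro φ hφ
  exact (key φ hφ.1).2 (hφ.2 ω hωQ)
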